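/- Let $d\ge 0$ and $p\ge 2$ be integers, $\beta\in(0,1)$, $T>0$, and let $\mathcal D\subseteq\mathbb R^d$ be open and convex. For each $n\ge 0$ let $L^{(n)}$ be a real-valued function that is $2p$ times continuously differentiable on $\mathcal D$, and suppose that there is a constant $M$ such that $\|\nabla^r L^{(n)}(\theta)\|\le M$ (Euclidean operator norm) for all $n\ge 0$, $1\le r\le 2p$ and $\theta\in\mathcal D$. For $i,l\ge 0$ let $$\mathcal K_{i,l}=\{(k_0,\ldots,k_l)\in\mathbb Z_{\ge 0}^{l+1}: k_0+\cdots+k_l=i,\ k_1+2k_2+\cdots+l\,k_l=l\}.$$ Define vector fields $f^{(n)}_m$ (memoryless iteration coefficients, $m\ge 1$, $n\ge 0$) and $H^{(n,a)}_m$ (history terms, $m\ge 1$, $1\le a\le n$) on $\mathcal D$ recursively by $$f^{(n)}_1(\theta)=-\sum_{k=0}^n\beta^k\nabla L^{(n-k)}(\theta),$$ $$f^{(n)}_m(\theta)=-\sum_{k=1}^n\beta^k\sum_{\substack{i,l\ge 0\\ i+l=m-1}}\ \sum_{(i_0,\ldots,i_l)\in\mathcal K_{i,l}}\frac{1}{i_0!\cdots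 i_l!}\,\nabla^{i+1}L^{(n-k)}(\theta)\bigl(\underbrace{H^{(n,k)}_1(\theta)}_{i_0\text{ times}},\ldots,\underbrace{H^{(n,k)}_{l+1}(\theta)}_{i_l\text{ times}}\bigr),\qquad m\ge 2,$$ $$H^{(n,a)}_m(\theta)=-\sum_{s=1}^a\ \sum_{\substack{j\ge 1,\ i,l\ge 0\\ i+j+l=m}}\ \sum_{(k_0,\ldots,k_l)\in\mathcal K_{i,l}}\frac{1}{k_0!\cdots k_l!}\,\nabla^{i}f^{(n-s)}_j(\theta)\bigl(\underbrace{H^{(n,s)}_1(\theta)}_{k_0\text{ times}},\ldots,\underbrace{H^{(n,s)}_{l+1}(\theta)}_{k_l\text{ times}}\bigr),\qquad m\ge 1,$$ where $\nabla^{i+1}L$ applied to $i$ vectors denotes the vector obtained by leaving one slot of the tensor free. Then there are constants $C_1,C_2$ (which may depend on $p,\beta,T,\mathcal D$ and the family $(L^{(n)})$, but not on $h$, on $n$ or on the initial point) such that the following holds for every $h\in(0,1/2)$. Let $(\theta^{(n)})_{n\ge 0}\subset\mathcal D$ be the mini-batch heavy-ball iteration $$\theta^{(n+1)}=\theta^{(n)}-h\sum_{k=0}^n\beta^k\nabla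 L^{(n-k)}(\theta^{(n-k)}),\qquad n\ge 0,$$ and let $(\tilde\theta^{(n)})_{n\ge 0}\subset\mathcal D$ be the memoryless iteration $$\tilde\theta^{(n+1)}=\tilde\theta^{(n)}+\sum_{j=1}^p h^j f^{(n)}_j(\tilde\theta^{(n)}),\qquad n\ge 0,$$ with $\tilde\theta^{(0)}=\theta^{(0)}$ (both sequences are assumed to stay in $\mathcal D$). Then $$\sup_{0\le n\le\lfloor T/h\rfloor}\Bigl\|\tilde\theta^{(n+1)}-\tilde\theta^{(n)}+h\sum_{k=0}^n\beta^k\nabla L^{(n-k)}(\tilde\theta^{(n-k)})\Bigr\|\le C_1h^{p+1}$$ and $$\sup_{0\le n\le\lfloor T/h\rfloor}\bigl\|\theta^{(n)}-\tilde\theta^{(n)}\bigr\|\le C_2h^{p}.$$ -/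

import Mathlib

noncomputable section

/-- The parameter space `ℝ^d` with the Euclidean norm. -/
abbrev ParamSpace (d : ℕ) : Type := EuclideanSpace ℝ (Fin d)

/-- The set of all tuples `(k_0, …, k_l)` of non-negative integers with
`k_0 + ⋯ + k_l = i` and `k_1 + 2 k_2 + ⋯ + l k_l = l`. -/
def multIdx (i l : ℕ) : Finset (Fin (l + 1) → ℕ) :=
  (Finset.piAntidiag Finset.univ i).filter
    (fun k => ∑ t : Fin (l + 1), (t : ℕ) * k t = l)

/-- For a tuple `k = (k_0, …, k_l)`, with `i = k_0 + ⋯ + k_l`, and vectors `H_0, …, H_l`, the vector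
`1 / (k_0! ⋯ k_l!) ∇^i g(x)(H_0, …, H_0, …, H_l, …, H_l)`, in which `H_t` occurs `k_t` times. -/
def blockTerm {d l : ℕ} (g : ParamSpace d → ParamSpace d) (x : ParamSpace d)
    (k : Fin (l + 1) → ℕ) (H : Fin (l + 1) → ParamSpace d) : ParamSpace d :=
  (1 / ((∏ t, (k t).factorial : ℕ) : ℝ)) •
    iteratedFDeriv ℝ (∑ t, k t) g x (fun r => H (finSigmaFinEquiv.symm r).1)

mutual

/-- The memoryless iteration coefficient `f_m^{(n)}(x)`, for `m ≥ 1`. The tensor `∇^{i + 1} L`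
applied to `i` vectors is the `i`-th derivative of the gradient of `L`, applied to these vectors.
The test `t + 1 < m` is there for the recursion only: a history term that fails it is never an
actual argument, see `memorylessCoef_of_two_le`. -/
def memorylessCoef {d : ℕ} (L : ℕ → ParamSpace d → ℝ) (β : ℝ) (m n : ℕ) (x : ParamSpace d) :
    ParamSpace d :=
  if m = 0 then 0
  else if m = 1 then
    -∑ k ∈ Finset.range (n + 1), β ^ k • gradient (L (n - k)) x
  else
    -∑ k ∈ Finset.Icc 1 n, β ^ k • ∑ q ∈ Finset.HasAntidiagonal.antidiagonal (m - 1), ∑ κ ∈ multIdx q.1 q.2,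
      blockTerm (gradient (L (n - k))) x κ
        (fun t => if _ht : (t : ℕ) + 1 < m then historyCoef L β (t + 1) n k x else 0)
termination_by 2 * m

/-- The history term of order `m` at step `n` and lag `a`, for `m ≥ 1` and `1 ≤ a ≤ n`; the first
sum index `j` of the inner sum is shifted by one. The test `t + 1 < m` is there for the recursion
only, see `historyCoef_eq`. -/
def historyCoef {d : ℕ} (L : ℕ → ParamSpace d → ℝ) (β : ℝ) (m n a : ℕ) (x : ParamSpace d) :
    ParamSpace d :=
  -∑ s ∈ Finset.Icc 1 a, ∑ j : Fin m, ∑ q ∈ Finset.HasAntidiagonal.antidiagonal (m - (j + 1)),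
    ∑ κ ∈ multIdx q.1 q.2,
      blockTerm (fun y => memorylessCoef L β (j + 1) (n - s) y) x κ
        (fun t => if _ht : (t : ℕ) + 1 < m then historyCoef L β (t + 1) n s x else 0)
termination_by 2 * m + 1

end

theorem mem_multIdx {i l : ℕ} {k : Fin (l + 1) → ℕ} :
    k ∈ multIdx i l ↔ ∑ t, k t = i ∧ ∑ t : Fin (l + 1), (t : ℕ) * k t = l := by
  simp [multIdx, Finset.mem_piAntidiag]

/-- `blockTerm` depends only on those `H_t` with `k_t ≠ 0`. -/
theorem blockTerm_congr {d l : ℕ} (g : ParamSpace d → ParamSpace d) (x : ParamSpace d)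
    (k : Fin (l + 1) → ℕ) (H H' : Fin (l + 1) → ParamSpace d)
    (h : ∀ t, k t ≠ 0 → H t = H' t) : blockTerm g x k H = blockTerm g x k H' := by
  unfold blockTerm
  congr 2
  funext r
  apply h
  have := (finSigmaFinEquiv.symm r).2.isLt
  omega

theorem memorylessCoef_one {d : ℕ} (L : ℕ → ParamSpace d → ℝ) (β : ℝ) (n : ℕ)
    (x : ParamSpace d) :
    memorylessCoef L β 1 n x =
      -∑ k ∈ Finset.range (n + 1), β ^ k • gradient (L (n - k)) x := by
  rw [memorylessCoef]; simp

/-- The defining formula of `f_m^{(n)}` for `m ≥ 2`. -/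
theorem memorylessCoef_of_two_le {d : ℕ} (L : ℕ → ParamSpace d → ℝ) (β : ℝ) {m : ℕ} (hm : 2 ≤ m)
    (n : ℕ) (x : ParamSpace d) :
    memorylessCoef L β m n x =
      -∑ k ∈ Finset.Icc 1 n, β ^ k • ∑ q ∈ Finset.HasAntidiagonal.antidiagonal (m - 1), ∑ κ ∈ multIdx q.1 q.2,
        blockTerm (gradient (L (n - k))) x κ (fun t => historyCoef L β (t + 1) n k x) := by
  rw [memorylessCoef, if_neg (by omega), if_neg (by omega)]
  congr 1
  refine Finset.sum_congr rfl fun k _ => ?_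
  congr 1
  refine Finset.sum_congr rfl fun q hq => Finset.sum_congr rfl fun κ hκ => ?_
  refine blockTerm_congr _ _ _ _ _ fun t ht => ?_
  have h1 := (mem_multIdx.1 hκ).1
  have h2 := Finset.single_le_sum (f := κ) (fun _ _ => Nat.zero_le _) (Finset.mem_univ t)
  have h3 := Finset.HasAntidiagonal.mem_antidiagonal.1 hq
  have h4 := t.isLt
  rw [dif_pos (by omega)]

/-- The defining formula of the history terms. -/
theorem historyCoef_eq {d : ℕ} (L : ℕ → ParamSpace d → ℝ) (β : ℝ) (m n a : ℕ)
    (x : ParamSpace d) :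
    historyCoef L β m n a x =
      -∑ s ∈ Finset.Icc 1 a, ∑ j ∈ Finset.Icc 1 m, ∑ q ∈ Finset.HasAntidiagonal.antidiagonal (m - j),
        ∑ κ ∈ multIdx q.1 q.2,
          blockTerm (memorylessCoef L β j (n - s)) x κ
            (fun t => historyCoef L β (t + 1) n s x) := by
  rw [historyCoef]
  congr 1
  refine Finset.sum_congr rfl fun s _ => ?_
  rw [Finset.sum_bij (fun (j : Fin m) _ => (j : ℕ) + 1)]
  · intro j _; simp
  · intro j _ j' _ h; exact Fin.ext (by simpa using h)
  · intro b hb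
    have := Finset.mem_Icc.1 hb
    exact ⟨⟨b - 1, by omega⟩, Finset.mem_univ _, by simp; omega⟩
  · intro j _
    refine Finset.sum_congr rfl fun q hq => Finset.sum_congr rfl fun κ hκ => ?_
    refine blockTerm_congr _ _ _ _ _ fun t ht => ?_
    have h1 := (mem_multIdx.1 hκ).1
    have h2 := Finset.single_le_sum (f := κ) (fun _ _ => Nat.zero_le _) (Finset.mem_univ t)
    have h3 := Finset.HasAntidiagonal.mem_antidiagonal.1 hq
    have h4 := t.isLt
    have h5 := j.isLt
    rw [dif_pos (by omega)]

/-- The mini-batch heavy-ball iteration (with zero initial velocity), with momentum parameter `β`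
and step size `h`. -/
def IsHeavyBall {d : ℕ} (L : ℕ → ParamSpace d → ℝ) (β h : ℝ) (θ : ℕ → ParamSpace d) : Prop :=
  ∀ n, θ (n + 1) = θ n - h • ∑ k ∈ Finset.range (n + 1), β ^ k • gradient (L (n - k)) (θ (n - k))

/-- The memoryless iteration of order `p`. -/
def IsMemoryless {d : ℕ} (L : ℕ → ParamSpace d → ℝ) (β h : ℝ) (p : ℕ) (θ : ℕ → ParamSpace d) :
    Prop :=
  ∀ n, θ (n + 1) = θ n + ∑ j ∈ Finset.Icc 1 p, h ^ j • memorylessCoef L β j n (θ n)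

end

-- Write x for the memoryless iterate at step n. Going back a steps subtracts the increments at
-- steps n - 1, …, n - a, and expanding each f_j at an earlier iterate around x gives a formal
-- series x + h H_1 + h² H_2 + ⋯ for that iterate. Comparing powers of h yields exactly the
-- recursion for `historyCoef`. Substituting the series with lag k into each gradient of the
-- heavy-ball sum, f_m is the coefficient of h^m in -h ∑ β^k ∇L(earlier iterate). So the memoryless
-- iteration satisfies the heavy-ball recursion up to the truncation error, of order h^(p+1).
--
-- Three points make this rigorous. The sums over `multIdx` are Taylor coefficients with equal terms
-- collected: derivatives are symmetric and multinomial coefficients count the orderings, which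
-- leads to `expansionCoef`. Next, the estimates are uniform in n: history terms and their
-- remainders grow only polynomially in the lag (`exists_derivBdd_coef`, `exists_history_approx`),
-- and the weights β^k absorb any polynomial (`exists_sum_pow_mul_le`). Regularity is budgeted by
-- letting f_j and H_j keep 2p - j bounded derivatives.
--
-- Finally, `norm_sub_le_of_perturbed_heavyBall` is a discrete Gronwall argument: about T/h local
-- errors of size h^(p+1) accumulate to order h^p.

section

open Finset

-- Symmetry of higher derivatives

/-- The derivatives of a `C^n` function are invariant under exchanging two adjacent arguments. -/
theorem iteratedFDeriv_comp_swap {E F : Type*} [NormedAddCommGroup E] [NormedSpace ℝ E]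
    [NormedAddCommGroup F] [NormedSpace ℝ F] {g : E → F} :
    ∀ {n : ℕ} {x : E} (_ : ContDiffAt ℝ (n + 1 : ℕ) g x) (i : Fin n) (v : Fin (n + 1) → E),
      iteratedFDeriv ℝ (n + 1) g x (v ∘ Equiv.swap i.castSucc i.succ) =
        iteratedFDeriv ℝ (n + 1) g x v
  | 0, _, _, i, _ => i.elim0
  | n + 1, x, hg, i, v => by
    have hev : ∀ᶠ y in nhds x, ContDiffAt ℝ (n + 1 + 1 : ℕ) g y := hg.eventually (by simp)
    have hd : DifferentiableAt ℝ (iteratedFDeriv ℝ (n + 1) g) x :=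
      hg.differentiableAt_iteratedFDeriv (by exact_mod_cast Nat.lt_succ_self _)
    have key : ∀ w : Fin (n + 2) → E, iteratedFDeriv ℝ (n + 2) g x w =
        fderiv ℝ (fun y => iteratedFDeriv ℝ (n + 1) g y (Fin.tail w)) x (w 0) :=
      fun w => hd.iteratedFDeriv_succ_apply_left'
    -- Exchanging the first two slots is symmetry of the second derivative of the n-th derivative.
    -- Any other adjacent exchange fixes slot 0, so it follows by differentiating the lower-order
    -- identity, which holds in a neighbourhood of x.
    refine Fin.cases ?_ (fun j => ?_) i
    · have hC : ContDiffAt ℝ 2 (iteratedFDeriv ℝ n g) x :=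
        hg.iteratedFDeriv_right (m := 2) (by norm_cast; omega)
      have hs := (hC.isSymmSndFDerivAt (by simp)).eq (v 1) (v 0)
      have h2 : ∀ w : Fin (n + 2) → E, iteratedFDeriv ℝ (n + 2) g x w =
          fderiv ℝ (fderiv ℝ (iteratedFDeriv ℝ n g)) x (w 0) (w 1)
            (Fin.tail (Fin.tail w)) := by
        intro w
        exact congrArg (fun A : E →L[ℝ] E [×(n + 1)]→L[ℝ] F => A (w 0) (Fin.tail w))
          (LinearIsometryEquiv.comp_fderiv
            (continuousMultilinearCurryLeftEquiv ℝ (fun _ : Fin (n + 1) => E) F).symm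
            (f := fderiv ℝ (iteratedFDeriv ℝ n g)) (x := x))
      have ht : Fin.tail (Fin.tail (v ∘ Equiv.swap (Fin.castSucc 0) (Fin.succ (0 : Fin (n + 1))))) =
          Fin.tail (Fin.tail v) := by
        funext t
        simp only [Fin.tail, Function.comp]
        rw [Equiv.swap_apply_of_ne_of_ne] <;> simp [Fin.ext_iff]
      rw [h2, h2, ht]
      simp only [Function.comp, Fin.castSucc_zero, Fin.succ_zero_eq_one, Equiv.swap_apply_left,
        Equiv.swap_apply_right]
      rw [hs]
    · have h0 : (v ∘ Equiv.swap j.succ.castSucc j.succ.succ) 0 = v 0 := by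
        simp only [Function.comp]
        rw [Equiv.swap_apply_of_ne_of_ne] <;> simp [Fin.ext_iff]
      have ht : Fin.tail (v ∘ Equiv.swap j.succ.castSucc j.succ.succ) =
          Fin.tail v ∘ Equiv.swap j.castSucc j.succ := by
        funext t
        simp only [Fin.tail, Function.comp, Equiv.swap_apply_def, Fin.ext_iff]
        congr 1
        split_ifs <;> simp_all
      rw [key, key, h0, ht]
      congr 1
      apply Filter.EventuallyEq.fderiv_eq
      filter_upwards [hev] with y hy
      exact iteratedFDeriv_comp_swap (hy.of_le (by exact_mod_cast Nat.le_succ _)) j (Fin.tail v)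

/-- The `n`-th derivative of a `C^n` function is symmetric. -/
theorem iteratedFDeriv_comp_perm {E F : Type*} [NormedAddCommGroup E] [NormedSpace ℝ E]
    [NormedAddCommGroup F] [NormedSpace ℝ F] {g : E → F} {n : ℕ} {x : E}
    (hg : ContDiffAt ℝ n g x) (σ : Equiv.Perm (Fin n)) (v : Fin n → E) :
    iteratedFDeriv ℝ n g x (v ∘ σ) = iteratedFDeriv ℝ n g x v := by
  cases n with
  | zero => congr 1; funext i; exact i.elim0
  | succ n =>
    -- Adjacent transpositions generate the symmetric group.
    have hσ : σ ∈ Submonoid.closure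
        (Set.range fun i : Fin n => Equiv.swap i.castSucc i.succ) := by
      rw [Equiv.Perm.mclosure_swap_castSucc_succ]; trivial
    induction hσ using Submonoid.closure_induction generalizing v with
    | mem τ hτ => obtain ⟨i, rfl⟩ := hτ; exact iteratedFDeriv_comp_swap hg i v
    | one => rfl
    | mul σ τ _ _ hσ hτ =>
      rw [Equiv.Perm.coe_mul, ← Function.comp_assoc, hτ, hσ]

-- Multinomial counting and expansion coefficients

/-- Two functions whose fibres have the same sizes differ by a permutation. -/
theorem exists_perm_comp_eq_of_card_fiber_eq {α β : Type*} [Fintype α] [DecidableEq β]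
    (φ ψ : α → β) (h : ∀ b, #{a | φ a = b} = #{a | ψ a = b}) :
    ∃ σ : Equiv.Perm α, ψ ∘ σ = φ := by
  have e : ∀ b, Nonempty ({a // φ a = b} ≃ {a // ψ a = b}) := fun b =>
    Fintype.card_eq.1 (by rw [Fintype.card_subtype, Fintype.card_subtype, h b])
  exact ⟨Equiv.ofFiberEquiv fun b => (e b).some,
    funext fun a => Equiv.ofFiberEquiv_map (fun b => (e b).some) a⟩

/-- The number of maps with prescribed sizes of the fibres is a multinomial coefficient. -/
theorem card_filter_card_fiber_eq {N M : ℕ} (κ : Fin M → ℕ)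
    (hκ : ∑ b, κ b = N) :
    #{φ : Fin N → Fin M | ∀ b, #{r | φ r = b} = κ b} = Nat.multinomial univ κ := by
  -- The count is the coefficient of ∏ X_b^(κ b) in (∑ X_b)^N: multiply out over all maps φ on one
  -- side, use the multinomial theorem on the other.
  have hX : ∀ k : Fin M → ℕ, ∏ b, (MvPolynomial.X b : MvPolynomial (Fin M) ℕ) ^ k b =
      MvPolynomial.monomial (Finsupp.equivFunOnFinite.symm k) 1 := by
    intro k
    rw [MvPolynomial.monomial_eq, Finsupp.prod_fintype _ _ (by simp)]
    simp
  have h1 : (∑ b, (MvPolynomial.X b : MvPolynomial (Fin M) ℕ)) ^ N =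
      ∑ φ : Fin N → Fin M, ∏ b, MvPolynomial.X b ^ #{r | φ r = b} := by
    have := prod_univ_sum (fun _ : Fin N => (univ : Finset (Fin M)))
      (fun _ b => (MvPolynomial.X b : MvPolynomial (Fin M) ℕ))
    rw [prod_const, card_univ, Fintype.card_fin, Fintype.piFinset_univ] at this
    rw [this]
    refine sum_congr rfl fun φ _ => ?_
    rw [← prod_fiberwise_of_maps_to (g := φ) (t := univ) (fun _ _ => mem_univ _)]
    refine prod_congr rfl fun b _ => ?_
    rw [← prod_const]
    refine prod_congr rfl fun r hr => ?_
    rw [(mem_filter.1 hr).2]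
  have h2 := sum_pow_eq_sum_piAntidiag univ (fun b => (MvPolynomial.X b : MvPolynomial (Fin M) ℕ)) N
  rw [h1] at h2
  have h3 := congrArg (MvPolynomial.coeff (Finsupp.equivFunOnFinite.symm κ)) h2
  simp only [hX, MvPolynomial.coeff_sum, MvPolynomial.coeff_monomial,
    EmbeddingLike.apply_eq_iff_eq, ← map_natCast MvPolynomial.C, MvPolynomial.coeff_C_mul] at h3
  rw [card_filter]
  convert h3 using 1
  · exact sum_congr rfl fun φ _ => by simp [funext_iff]
  · rw [sum_eq_single κ]
    · simp
    · intro k _ hk; simp [hk]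
    · intro h; exact absurd (mem_piAntidiag.2 ⟨hκ, by simp⟩) h

/-- The coefficient of `h ^ r` in the formal expansion of `g (x + ∑ t, h ^ (t + 1) • V t)`. -/
noncomputable def expansionCoef {E F : Type*} [NormedAddCommGroup E] [NormedSpace ℝ E]
    [NormedAddCommGroup F] [NormedSpace ℝ F] (g : E → F) (x : E) (V : ℕ → E) (r : ℕ) : F :=
  ∑ q ∈ antidiagonal r, ((q.1.factorial : ℝ)⁻¹) •
    ∑ φ ∈ piAntidiag (univ : Finset (Fin q.1)) q.2, iteratedFDeriv ℝ q.1 g x fun j => V (φ j)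

/-- By symmetry all orderings of the arguments give the same value, and there are i! / ∏ κ_t! of
them, so the weight 1 / ∏ κ_t! becomes 1 / i! on each ordering. -/
theorem blockTerm_eq_sum {d l i : ℕ} {g : ParamSpace d → ParamSpace d} {x : ParamSpace d}
    (hg : ContDiffAt ℝ i g x) {κ : Fin (l + 1) → ℕ} (hκ : ∑ t, κ t = i)
    (V : Fin (l + 1) → ParamSpace d) :
    blockTerm g x κ V = ((i.factorial : ℝ)⁻¹) •
      ∑ φ : Fin i → Fin (l + 1) with ∀ b, #{r | φ r = b} = κ b,
        iteratedFDeriv ℝ i g x (fun j => V (φ j)) := by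
  subst hκ
  have hψ : ∀ b, #{r : Fin (∑ t, κ t) | (finSigmaFinEquiv.symm r).1 = b} = κ b := by
    intro b
    have : #{z : (t : Fin (l + 1)) × Fin (κ t) | z.1 = b} = κ b := by
      rw [← Fintype.card_subtype, Fintype.card_congr (Equiv.sigmaSubtype b), Fintype.card_fin]
    conv_rhs => rw [← this]
    refine card_bij (fun r _ => finSigmaFinEquiv.symm r) ?_ ?_ ?_
    · intro r hr; simpa using hr
    · intro r _ r' _ h; exact finSigmaFinEquiv.symm.injective h
    · intro z hz
      exact ⟨finSigmaFinEquiv z, by simpa using hz, by simp⟩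
  rw [sum_congr rfl (g := fun _ => iteratedFDeriv ℝ (∑ t, κ t) g x
    (fun r => V (finSigmaFinEquiv.symm r).1))]
  · rw [sum_const, card_filter_card_fiber_eq κ rfl, blockTerm, ← Nat.cast_smul_eq_nsmul ℝ,
      smul_smul]
    congr 1
    have h := Nat.multinomial_spec univ κ
    rw [← h]
    have h1 : ((∏ t, (κ t).factorial : ℕ) : ℝ) ≠ 0 := by
      exact_mod_cast (prod_ne_zero_iff.2 fun t _ => Nat.factorial_ne_zero _)
    have h2 : (Nat.multinomial univ κ : ℝ) ≠ 0 := by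
      exact_mod_cast (Nat.multinomial_pos _ _).ne'
    push_cast at h1 ⊢
    field_simp
  · intro φ hφ
    obtain ⟨σ, hσ⟩ := exists_perm_comp_eq_of_card_fiber_eq φ
      (fun r => (finSigmaFinEquiv.symm r).1) (fun b => by
        rw [(mem_filter.1 hφ).2 b, hψ])
    rw [← hσ]
    exact iteratedFDeriv_comp_perm hg σ (fun r => V (finSigmaFinEquiv.symm r).1)

/-- Tuples φ are grouped by their occupation numbers κ_b = #{r | φ r = b}. The weight condition in
`multIdx` says that the entries of φ sum to l, which also forces every entry to be at most l. -/
theorem sum_multIdx_blockTerm {d : ℕ} {i l : ℕ} {g : ParamSpace d → ParamSpace d}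
    {x : ParamSpace d} (hg : ContDiffAt ℝ i g x) (V : ℕ → ParamSpace d) :
    ∑ κ ∈ multIdx i l, blockTerm g x κ (fun t => V t) = ((i.factorial : ℝ)⁻¹) •
      ∑ φ ∈ piAntidiag (univ : Finset (Fin i)) l, iteratedFDeriv ℝ i g x fun j => V (φ j) := by
  rw [sum_congr rfl fun κ hκ => blockTerm_eq_sum hg (mem_multIdx.1 hκ).1 (fun t => V t),
    ← smul_sum]
  congr 1
  have hcard : ∀ φ : Fin i → Fin (l + 1), ∑ b, #{r | φ r = b} = i := fun φ => by
    rw [← card_eq_sum_card_fiberwise (fun _ _ => mem_univ _), card_univ, Fintype.card_fin]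
  have hwt : ∀ φ : Fin i → Fin (l + 1), ∑ b : Fin (l + 1), (b : ℕ) * #{r | φ r = b} = ∑ r, (φ r : ℕ) := by
    intro φ
    rw [← sum_fiberwise_of_maps_to (g := φ) (t := univ) (fun _ _ => mem_univ _)]
    refine sum_congr rfl fun b _ => ?_
    rw [sum_congr rfl fun r hr => by rw [(mem_filter.1 hr).2], sum_const, smul_eq_mul, mul_comm]
  have h1 : ∑ κ ∈ multIdx i l, ∑ φ : Fin i → Fin (l + 1) with ∀ b, #{r | φ r = b} = κ b,
        iteratedFDeriv ℝ i g x (fun j => V (φ j)) =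
      ∑ φ : Fin i → Fin (l + 1) with ∑ r, (φ r : ℕ) = l,
        iteratedFDeriv ℝ i g x (fun j => V (φ j)) := by
    rw [← sum_fiberwise_of_maps_to (g := fun (φ : Fin i → Fin (l + 1)) b => #{r | φ r = b}) (t := multIdx i l)]
    · refine sum_congr rfl fun κ hκ => sum_congr ?_ fun _ _ => rfl
      ext φ
      simp only [mem_filter, mem_univ, true_and]
      constructor
      · intro h
        have h' : (fun b => #{r | φ r = b}) = κ := funext h
        refine ⟨?_, h'⟩
        have h2 := (mem_multIdx.1 hκ).2
        rw [← h'] at h2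
        exact (hwt φ).symm.trans h2
      · rintro ⟨_, rfl⟩ b; rfl
    · intro φ hφ
      rw [mem_multIdx]
      exact ⟨hcard φ, (hwt φ).trans (mem_filter.1 hφ).2⟩
  rw [h1]
  refine sum_bij (fun φ _ r => (φ r : ℕ)) ?_ ?_ ?_ ?_
  · intro φ hφ; simpa [mem_piAntidiag] using hφ
  · intro φ _ ψ _ h
    funext r
    exact Fin.ext (congrFun h r)
  · intro φ hφ
    have h : ∑ r, φ r = l := (mem_piAntidiag.1 hφ).1
    have hle : ∀ r, φ r < l + 1 := fun r => by
      have := single_le_sum (f := φ) (fun _ _ => Nat.zero_le _) (mem_univ r)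
      omega
    exact ⟨fun r => ⟨φ r, hle r⟩, by simpa using h, rfl⟩
  · intro φ _; rfl

theorem sum_antidiagonal_blockTerm {d r : ℕ} {g : ParamSpace d → ParamSpace d}
    {x : ParamSpace d} (hg : ContDiffAt ℝ r g x) (V : ℕ → ParamSpace d) :
    ∑ q ∈ antidiagonal r, ∑ κ ∈ multIdx q.1 q.2, blockTerm g x κ (fun t => V t) =
      expansionCoef g x V r :=
  sum_congr rfl fun q hq => sum_multIdx_blockTerm (hg.of_le (by
    have := mem_antidiagonal.1 hq
    exact_mod_cast (by omega : q.1 ≤ r))) V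

-- Calculus of functions with bounded derivatives

/-- `g` is `k` times continuously differentiable on `D`, and its derivatives of orders `0, …, k`
are bounded by `C` there. -/
def DerivBdd {E F : Type*} [NormedAddCommGroup E] [NormedSpace ℝ E]
    [NormedAddCommGroup F] [NormedSpace ℝ F] (D : Set E) (k : ℕ) (C : ℝ) (g : E → F) : Prop :=
  ContDiffOn ℝ k g D ∧ ∀ r ≤ k, ∀ x ∈ D, ‖iteratedFDerivWithin ℝ r g D x‖ ≤ C

namespace DerivBdd

variable {E F G : Type*} [NormedAddCommGroup E] [NormedSpace ℝ E]
    [NormedAddCommGroup F] [NormedSpace ℝ F] [NormedAddCommGroup G] [NormedSpace ℝ G]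
    {D : Set E} {k : ℕ} {C C' : ℝ} {g : E → F}

theorem mono {k' : ℕ} (h : DerivBdd D k C g) (hk : k' ≤ k) (hC : C ≤ C') : DerivBdd D k' C' g :=
  ⟨h.1.of_le (by exact_mod_cast hk), fun r hr x hx => (h.2 r (hr.trans hk) x hx).trans hC⟩

theorem congr {g' : E → F} (h : DerivBdd D k C g) (hg : Set.EqOn g' g D) : DerivBdd D k C g' :=
  ⟨h.1.congr hg, fun r hr x hx => by
    rw [iteratedFDerivWithin_congr hg hx]; exact h.2 r hr x hx⟩

theorem norm_le (h : DerivBdd D k C g) {x : E} (hx : x ∈ D) : ‖g x‖ ≤ C := by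
  simpa using h.2 0 (Nat.zero_le _) x hx

theorem contDiffAt (h : DerivBdd D k C g) (hD : IsOpen D) {x : E} (hx : x ∈ D) :
    ContDiffAt ℝ k g x :=
  h.1.contDiffAt (hD.mem_nhds hx)

theorem norm_iteratedFDeriv_le (h : DerivBdd D k C g) (hD : IsOpen D) {r : ℕ} (hr : r ≤ k) {x : E}
    (hx : x ∈ D) : ‖iteratedFDeriv ℝ r g x‖ ≤ C := by
  rw [← iteratedFDerivWithin_of_isOpen r hD hx]
  exact h.2 r hr x hx

theorem sum {ι : Type*} {s : Finset ι} {g : ι → E → F} {C : ι → ℝ} (hD : IsOpen D)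
    (h : ∀ i ∈ s, DerivBdd D k (C i) (g i)) :
    DerivBdd D k (∑ i ∈ s, C i) fun x => ∑ i ∈ s, g i x := by
  refine ⟨ContDiffOn.sum fun i hi => (h i hi).1, fun r hr x hx => ?_⟩
  rw [iteratedFDerivWithin_fun_sum_apply hD.uniqueDiffOn hx fun i hi =>
    ((h i hi).mono hr le_rfl).1 x hx]
  exact (norm_sum_le _ _).trans (sum_le_sum fun i hi => (h i hi).2 r hr x hx)

theorem comp_iso (h : DerivBdd D k C g) (hD : IsOpen D) (e : F ≃ₗᵢ[ℝ] G) :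
    DerivBdd D k C fun x => e (g x) :=
  ⟨e.contDiff.comp_contDiffOn h.1, fun r hr x hx => by
    have := e.norm_iteratedFDerivWithin_comp_left g hD.uniqueDiffOn hx r
    exact this.le.trans (h.2 r hr x hx)⟩

theorem neg (h : DerivBdd D k C g) (hD : IsOpen D) : DerivBdd D k C fun x => -g x :=
  h.comp_iso hD (LinearIsometryEquiv.neg ℝ)

theorem const_smul (h : DerivBdd D k C g) (hD : IsOpen D) (c : ℝ) :
    DerivBdd D k (|c| * C) fun x => c • g x := by
  refine ⟨h.1.const_smul c, fun r hr x hx => ?_⟩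
  have := iteratedFDerivWithin_const_smul_apply (a := c)
    ((h.mono hr le_rfl).1 x hx) hD.uniqueDiffOn hx
  change ‖iteratedFDerivWithin ℝ r (c • g) D x‖ ≤ _
  rw [this, norm_smul, Real.norm_eq_abs]
  exact mul_le_mul_of_nonneg_left (h.2 r hr x hx) (abs_nonneg c)

/-- Leibniz rule; the factor 2^k bounds the sum of the binomial coefficients. -/
theorem clm_apply {A : E → F →L[ℝ] G} (hA : DerivBdd D k C A) (hg : DerivBdd D k C' g)
    (hD : IsOpen D) (hC : 0 ≤ C) (hC' : 0 ≤ C') :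
    DerivBdd D k (C * (2 ^ k * C')) fun x => A x (g x) := by
  refine ⟨hA.1.clm_apply hg.1, fun r hr x hx => ?_⟩
  refine (norm_iteratedFDerivWithin_clm_apply hA.1 hg.1 hD.uniqueDiffOn hx
    (by exact_mod_cast hr)).trans ?_
  calc _ ≤ ∑ i ∈ range (r + 1), (r.choose i : ℝ) * C * C' := by
        refine sum_le_sum fun i hi => ?_
        have hi' : i ≤ r := Nat.lt_succ_iff.1 (mem_range.1 hi)
        gcongr
        · exact hA.2 i (hi'.trans hr) x hx
        · exact hg.2 (r - i) ((Nat.sub_le _ _).trans hr) x hx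
    _ = 2 ^ r * (C * C') := by
        simp_rw [mul_assoc]
        rw [← sum_mul]
        congr 1
        exact_mod_cast Nat.sum_range_choose r
    _ ≤ 2 ^ k * (C * C') := by gcongr; norm_num
    _ = C * (2 ^ k * C') := by ring

theorem fderivWithin (h : DerivBdd D (k + 1) C g) (hD : IsOpen D) :
    DerivBdd D k C (fderivWithin ℝ g D) :=
  ⟨h.1.fderivWithin hD.uniqueDiffOn (by norm_cast), fun r hr x hx => by
    rw [norm_iteratedFDerivWithin_fderivWithin hD.uniqueDiffOn hx]
    exact h.2 (r + 1) (by omega) x hx⟩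

theorem iteratedFDerivWithin (hD : IsOpen D) : ∀ (i : ℕ) {k : ℕ}, DerivBdd D (k + i) C g →
    DerivBdd D k C (iteratedFDerivWithin ℝ i g D)
  | 0, _, h => h.comp_iso hD (continuousMultilinearCurryFin0 ℝ E F).symm
  | i + 1, k, h =>
    ((iteratedFDerivWithin hD i (k := k + 1) (h.mono (by omega) le_rfl)).fderivWithin hD).comp_iso
      hD (continuousMultilinearCurryLeftEquiv ℝ (fun _ : Fin (i + 1) => E) F).symm

/-- Currying off one slot at a time reduces this to `clm_apply`, each slot costing a factor 2^k C'.
-/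
theorem multilinear_apply (hD : IsOpen D) (hC' : 0 ≤ C') : ∀ {i : ℕ} {C : ℝ} (_ : 0 ≤ C)
    {A : E → E [×i]→L[ℝ] F} (_ : DerivBdd D k C A) {V : Fin i → E → E}
    (_ : ∀ j, DerivBdd D k C' (V j)),
    DerivBdd D k (C * (2 ^ k * C') ^ i) fun x => A x fun j => V j x
  | 0, C, _, A, hA, V, _ => by
    have := hA.comp_iso hD (continuousMultilinearCurryFin0 ℝ E F)
    refine (this.mono le_rfl (by simp)).congr fun x _ => ?_
    simp only [continuousMultilinearCurryFin0_apply]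
    congr 1
    exact Subsingleton.elim _ _
  | i + 1, C, hC, A, hA, V, hV => by
    have h1 := (hA.comp_iso hD
      (continuousMultilinearCurryLeftEquiv ℝ (fun _ : Fin (i + 1) => E) F)).clm_apply (hV 0) hD hC hC'
    have h2 := multilinear_apply hD hC' (by positivity) h1 fun j : Fin i => hV j.succ
    refine (h2.mono le_rfl (by rw [pow_succ']; exact le_of_eq (by ring))).congr fun x _ => ?_
    simp only [continuousMultilinearCurryLeftEquiv_apply]
    congr 1
    funext j
    refine Fin.cases ?_ (fun j => ?_) j <;> simp

/-- The coefficient of order r involves at most r derivatives of g and at most r of the vector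
fields. The constant K must not depend on g, V or the bounds, since these vary with the step and the
lag. -/
theorem expansionCoef (hD : IsOpen D) (k r : ℕ) : ∃ K : ℝ, 0 ≤ K ∧
    ∀ (g : E → F) (V : ℕ → E → E) (C B : ℝ), 0 ≤ C → 1 ≤ B → DerivBdd D (k + r) C g →
      (∀ t < r, DerivBdd D k B (V t)) →
      DerivBdd D k (K * C * B ^ r) fun x => expansionCoef g x (fun t => V t x) r := by
  refine ⟨∑ q ∈ antidiagonal r, |((q.1.factorial : ℝ)⁻¹)| *
    ∑ φ ∈ piAntidiag (univ : Finset (Fin q.1)) q.2, (2 ^ k) ^ r, by positivity,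
    fun g V C B hC hB hg hV => ?_⟩
  have hmain : DerivBdd D k (∑ q ∈ antidiagonal r, |((q.1.factorial : ℝ)⁻¹)| *
      ∑ φ ∈ piAntidiag (univ : Finset (Fin q.1)) q.2, (2 ^ k) ^ r * C * B ^ r)
      fun x => _root_.expansionCoef g x (fun t => V t x) r := by
    refine sum hD fun q hq => const_smul (sum hD fun φ hφ => ?_) hD _
    have hq' := mem_antidiagonal.1 hq
    have hφ' : ∑ j, φ j = q.2 := (mem_piAntidiag.1 hφ).1
    have hA := iteratedFDerivWithin hD q.1 (hg.mono (k' := k + q.1) (by omega) le_rfl)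
    have h1 := multilinear_apply hD (by positivity : 0 ≤ B) hC hA (V := fun j => V (φ j))
      fun j => hV _ (by
        have := single_le_sum (f := φ) (fun _ _ => Nat.zero_le _) (mem_univ j)
        have := j.isLt
        omega)
    refine (h1.mono le_rfl ?_).congr fun x hx => ?_
    · calc C * (2 ^ k * B) ^ q.1 ≤ C * (2 ^ k * B) ^ r := by
            gcongr
            · exact one_le_mul_of_one_le_of_one_le (one_le_pow₀ (by norm_num)) hB
            · omega
        _ = _ := by rw [mul_pow]; ring
    · simp only
      rw [iteratedFDerivWithin_of_isOpen q.1 hD hx]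
  refine hmain.mono le_rfl (le_of_eq ?_)
  simp only [← sum_mul, ← mul_assoc]

end DerivBdd

theorem DerivBdd.gradient {d : ℕ} {D : Set (ParamSpace d)} (hD : IsOpen D) {k : ℕ} {M : ℝ}
    {f : ParamSpace d → ℝ} (hf : ContDiffOn ℝ (k + 1 : ℕ) f D)
    (hM : ∀ r ∈ Icc 1 (k + 1), ∀ x ∈ D, ‖iteratedFDeriv ℝ r f x‖ ≤ M) :
    DerivBdd D k M (gradient f) := by
  have h : DerivBdd D k M (_root_.fderivWithin ℝ f D) :=
    ⟨hf.fderivWithin hD.uniqueDiffOn (by norm_cast), fun r hr x hx => by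
      rw [norm_iteratedFDerivWithin_fderivWithin hD.uniqueDiffOn hx,
        iteratedFDerivWithin_of_isOpen _ hD hx]
      exact hM (r + 1) (by simp; omega) x hx⟩
  refine (h.comp_iso hD (InnerProductSpace.toDual ℝ (ParamSpace d)).symm).congr fun x hx => ?_
  simp only [_root_.gradient, fderivWithin_of_isOpen hD hx]

-- Taylor expansion in powers of h

section Taylor

variable {E F : Type*} [NormedAddCommGroup E] [NormedSpace ℝ E]
    [NormedAddCommGroup F] [NormedSpace ℝ F]

theorem norm_sub_taylor_le [CompleteSpace F] {D : Set E} (hD : IsOpen D) (hc : Convex ℝ D) {q : ℕ}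
    {C : ℝ} {g : E → F} (hg : DerivBdd D (q + 1) C g) {x y : E} (hx : x ∈ D) (hy : x + y ∈ D) :
    ‖g (x + y) - ∑ i ∈ range (q + 1), ((i.factorial : ℝ)⁻¹) • iteratedFDeriv ℝ i g x fun _ => y‖ ≤
      C * ‖y‖ ^ (q + 1) := by
  have hseg : ∀ t ∈ Set.Icc (0 : ℝ) 1, x + t • y ∈ D := fun t ht =>
    hc.add_smul_mem hx hy ht
  rw [map_add_eq_sum_add_integral_iteratedFDeriv (f := g) (x := x) (y := y) (n := q) fun t ht => by
    exact_mod_cast hg.contDiffAt hD (hseg t ht), add_sub_cancel_left, norm_smul]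
  have hint : ‖∫ t in (0 : ℝ)..1, (1 - t) ^ q • iteratedFDeriv ℝ (q + 1) g (x + t • y) fun _ => y‖ ≤
      C * ‖y‖ ^ (q + 1) * |1 - 0| := by
    refine intervalIntegral.norm_integral_le_of_norm_le_const fun t ht => ?_
    rw [Set.uIoc_of_le zero_le_one] at ht
    have h1 : ‖(1 - t) ^ q‖ ≤ 1 := by
      rw [norm_pow, Real.norm_eq_abs, abs_of_nonneg (by linarith [ht.2])]
      exact pow_le_one₀ (by linarith [ht.2]) (by linarith [ht.1])
    have h2 : ‖iteratedFDeriv ℝ (q + 1) g (x + t • y) fun _ => y‖ ≤ C * ‖y‖ ^ (q + 1) := by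
      refine (ContinuousMultilinearMap.le_opNorm _ _).trans ?_
      rw [prod_const, card_univ, Fintype.card_fin]
      gcongr
      exact hg.norm_iteratedFDeriv_le hD le_rfl (hseg t ⟨ht.1.le, ht.2⟩)
    rw [norm_smul]
    calc _ ≤ 1 * ‖iteratedFDeriv ℝ (q + 1) g (x + t • y) fun _ => y‖ := by gcongr
      _ ≤ _ := by rw [one_mul]; exact h2
  rw [sub_zero, abs_one, mul_one] at hint
  refine le_trans ?_ hint
  refine mul_le_of_le_one_left (norm_nonneg _) ?_
  rw [norm_inv, Real.norm_natCast]
  exact inv_le_one_of_one_le₀ (by exact_mod_cast Nat.factorial_pos q)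

/-- The sum of the first `q` terms of the expansion in `h`, as a part of the expansion of the
Taylor polynomial by multilinearity. -/
theorem sum_range_expansionCoef (g : E → F) (x : E) (W : ℕ → E) (q : ℕ) (h : ℝ) :
    ∑ r ∈ range q, h ^ r • expansionCoef g x W r =
      ∑ i ∈ range q, ((i.factorial : ℝ)⁻¹) •
        ∑ φ ∈ Fintype.piFinset (fun _ : Fin i => range q) with i + ∑ j, φ j < q,
          h ^ (i + ∑ j, φ j) • iteratedFDeriv ℝ i g x fun j => W (φ j) := by
  have h1 : ∀ r, h ^ r • expansionCoef g x W r = ∑ q' ∈ antidiagonal r,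
      ((q'.1.factorial : ℝ)⁻¹) • ∑ φ ∈ piAntidiag (univ : Finset (Fin q'.1)) q'.2,
        h ^ (q'.1 + ∑ j, φ j) • iteratedFDeriv ℝ q'.1 g x fun j => W (φ j) := by
    intro r
    rw [expansionCoef, smul_sum]
    refine sum_congr rfl fun q' hq' => ?_
    rw [smul_comm, smul_sum]
    congr 1
    refine sum_congr rfl fun φ hφ => ?_
    rw [(mem_piAntidiag.1 hφ).1, mem_antidiagonal.1 hq']
  have h2 : ∑ r ∈ range q, h ^ r • expansionCoef g x W r =
      ∑ i ∈ range q, ∑ l ∈ range (q - i), ((i.factorial : ℝ)⁻¹) •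
        ∑ φ ∈ piAntidiag (univ : Finset (Fin i)) l,
          h ^ (i + ∑ j, φ j) • iteratedFDeriv ℝ i g x fun j => W (φ j) := by
    simp_rw [h1]
    rw [sum_sigma', sum_sigma']
    refine sum_bij' (fun z _ => ⟨z.2.1, z.2.2⟩) (fun z _ => ⟨z.1 + z.2, (z.1, z.2)⟩) ?_ ?_ ?_ ?_ ?_
    · rintro ⟨r, i, l⟩ hz
      simp only [mem_sigma, mem_range, HasAntidiagonal.mem_antidiagonal] at hz ⊢
      omega
    · rintro ⟨i, l⟩ hz
      simp only [mem_sigma, mem_range, HasAntidiagonal.mem_antidiagonal, and_true] at hz ⊢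
      exact Nat.add_lt_of_lt_sub' hz.2
    · rintro ⟨r, i, l⟩ hz
      simp only [mem_sigma, HasAntidiagonal.mem_antidiagonal] at hz
      obtain ⟨_, rfl⟩ := hz
      rfl
    · rintro ⟨i, l⟩ _; rfl
    · rintro ⟨r, i, l⟩ _; rfl
  rw [h2]
  refine sum_congr rfl fun i _ => ?_
  rw [← smul_sum]
  congr 1
  rw [← sum_fiberwise_of_maps_to (g := fun φ : Fin i → ℕ => ∑ j, φ j) (t := range (q - i))]
  · refine sum_congr rfl fun l hl => sum_congr ?_ fun _ _ => rfl
    ext φ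
    have hl' := mem_range.1 hl
    simp only [mem_filter, mem_piAntidiag, Fintype.mem_piFinset, mem_range]
    constructor
    · rintro ⟨h, _⟩
      change ∑ j, φ j = l at h
      refine ⟨⟨fun j => ?_, by omega⟩, h⟩
      have := single_le_sum (f := φ) (fun _ _ => Nat.zero_le _) (mem_univ j)
      omega
    · rintro ⟨_, h⟩
      exact ⟨h, by simp⟩
  · intro φ hφ
    have := (mem_filter.1 hφ).2
    simp only [mem_range]
    omega

/-- If `y - x` is a polynomial in `h` without constant term, the expansion in powers of `h` of
`g y`, truncated before order `q`, has an error of order `h ^ q`. -/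
theorem exists_norm_sub_sum_expansionCoef_le [CompleteSpace F] (q : ℕ) : ∃ K : ℝ, 0 ≤ K ∧
    ∀ (D : Set E) (g : E → F) (C B h : ℝ) (x y : E) (W : ℕ → E), IsOpen D → Convex ℝ D →
      DerivBdd D q C g → 0 ≤ C → 1 ≤ B → 0 ≤ h → h ≤ 1 → x ∈ D → y ∈ D →
      (∀ t < q, ‖W t‖ ≤ B) → y - x = ∑ t ∈ range q, h ^ (t + 1) • W t →
      ‖g y - ∑ r ∈ range q, h ^ r • expansionCoef g x W r‖ ≤ K * C * B ^ q * h ^ q := by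
  rcases q with _ | q
  · refine ⟨1, zero_le_one, fun D g C B h x y W _ _ hg _ _ _ _ _ hy _ _ => ?_⟩
    simpa using hg.norm_le hy
  set q' := q + 1 with hq'
  -- The first summand comes from the Taylor remainder with ‖y - x‖ ≤ q' B h; the second counts the
  -- terms of the expanded Taylor polynomial.
  refine ⟨(q' : ℝ) ^ q' + ∑ i ∈ range q', ∑ φ ∈ Fintype.piFinset (fun _ : Fin i => range q'), 1,
    by positivity, fun D g C B h x y W hD hc hg hC hB h0 h1 hx hy hW hyx => ?_⟩
  have hynorm : ‖y - x‖ ≤ q' * B * h := by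
    rw [hyx]
    refine (norm_sum_le _ _).trans ?_
    calc _ ≤ ∑ t ∈ range q', B * h := sum_le_sum fun t ht => by
          rw [norm_smul, norm_pow, Real.norm_eq_abs, abs_of_nonneg h0, mul_comm]
          gcongr
          · exact hW t (mem_range.1 ht)
          · exact pow_le_of_le_one h0 h1 (Nat.succ_ne_zero _)
      _ = _ := by simp [mul_assoc]
  have hT := norm_sub_taylor_le hD hc hg hx (y := y - x) (by simpa using hy)
  rw [add_sub_cancel] at hT
  have hexp : ∀ i, (iteratedFDeriv ℝ i g x fun _ => y - x) =
      ∑ φ ∈ Fintype.piFinset (fun _ : Fin i => range q'),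
        h ^ (i + ∑ j, φ j) • iteratedFDeriv ℝ i g x fun j => W (φ j) := by
    intro i
    rw [hyx, ContinuousMultilinearMap.map_sum_finset _ (fun _ t => h ^ (t + 1) • W t)]
    refine sum_congr rfl fun φ _ => ?_
    rw [ContinuousMultilinearMap.map_smul_univ _ (fun j => h ^ (φ j + 1)) (fun j => W (φ j)),
      prod_pow_eq_pow_sum, sum_add_distrib]
    simp [add_comm]
  have hrest : ‖∑ i ∈ range q', ((i.factorial : ℝ)⁻¹) • (iteratedFDeriv ℝ i g x fun _ => y - x) -
      ∑ r ∈ range q', h ^ r • expansionCoef g x W r‖ ≤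
      ∑ i ∈ range q', ∑ φ ∈ Fintype.piFinset (fun _ : Fin i => range q'),
        1 * (C * B ^ q' * h ^ q') := by
    rw [sum_range_expansionCoef, ← sum_sub_distrib]
    refine (norm_sum_le _ _).trans (sum_le_sum fun i hi => ?_)
    have hi' := mem_range.1 hi
    -- The terms of total order below q' cancel exactly; the surviving ones carry at least h^q'.
    rw [hexp, ← smul_sub, ← sum_filter_add_sum_filter_not _ (fun φ : Fin i → ℕ => i + ∑ j, φ j < q'),
      add_sub_cancel_left, norm_smul]
    have hf : ‖((i.factorial : ℝ)⁻¹)‖ ≤ 1 := by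
      rw [norm_inv, Real.norm_natCast]
      exact inv_le_one_of_one_le₀ (by exact_mod_cast Nat.factorial_pos i)
    refine (mul_le_of_le_one_left (norm_nonneg _) hf).trans ((norm_sum_le _ _).trans ?_)
    refine le_trans (sum_le_sum fun φ hφ => ?_)
      (sum_le_sum_of_subset_of_nonneg (filter_subset _ _) fun _ _ _ => by positivity)
    have hφ1 := Fintype.mem_piFinset.1 (mem_filter.1 hφ).1
    have hφ2 := (mem_filter.1 hφ).2
    rw [norm_smul, norm_pow, Real.norm_eq_abs, abs_of_nonneg h0, one_mul, mul_comm]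
    refine mul_le_mul ?_ (pow_le_pow_of_le_one h0 h1 (not_lt.1 hφ2)) (by positivity)
      (by positivity)
    · refine (ContinuousMultilinearMap.le_opNorm _ _).trans ?_
      gcongr
      · exact hg.norm_iteratedFDeriv_le hD (by omega) hx
      · calc ∏ j, ‖W (φ j)‖ ≤ ∏ j : Fin i, B :=
              prod_le_prod (fun _ _ => norm_nonneg _) fun j _ => hW _ (mem_range.1 (hφ1 j))
          _ = B ^ i := by simp
          _ ≤ B ^ q' := pow_le_pow_right₀ hB hi'.le
  calc _ = ‖(g y - ∑ i ∈ range q', ((i.factorial : ℝ)⁻¹) • iteratedFDeriv ℝ i g x fun _ => y - x) +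
        (∑ i ∈ range q', ((i.factorial : ℝ)⁻¹) • (iteratedFDeriv ℝ i g x fun _ => y - x) -
          ∑ r ∈ range q', h ^ r • expansionCoef g x W r)‖ := by
        congr 1; abel
    _ ≤ C * (q' * B * h) ^ q' + ∑ i ∈ range q',
        ∑ φ ∈ Fintype.piFinset (fun _ : Fin i => range q'), 1 * (C * B ^ q' * h ^ q') := by
        refine (norm_add_le _ _).trans (add_le_add (hT.trans ?_) hrest)
        gcongr
    _ = _ := by
        simp_rw [← sum_mul]
        ring

end Taylor

theorem expansionCoef_congr {E F : Type*} [NormedAddCommGroup E] [NormedSpace ℝ E]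
    [NormedAddCommGroup F] [NormedSpace ℝ F] (g : E → F) (x : E) {V V' : ℕ → E} {r : ℕ}
    (h : ∀ t < r, V t = V' t) : expansionCoef g x V r = expansionCoef g x V' r := by
  refine sum_congr rfl fun q hq => ?_
  congr 1
  refine sum_congr rfl fun φ hφ => ?_
  have hφ' : ∑ j, φ j = q.2 := (mem_piAntidiag.1 hφ).1
  have hq' := mem_antidiagonal.1 hq
  congr 1
  funext j
  have := single_le_sum (f := φ) (fun _ _ => Nat.zero_le _) (mem_univ j)
  have := j.isLt
  exact h _ (by omega)

/-- Variant of `exists_norm_sub_sum_expansionCoef_le` for an approximate expansion of `y - x`. -/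
theorem exists_norm_sub_sum_expansionCoef_le_of_approx {E F : Type*} [NormedAddCommGroup E]
    [NormedSpace ℝ E] [NormedAddCommGroup F] [NormedSpace ℝ F] [CompleteSpace F] {q : ℕ}
    (hq : 1 ≤ q) : ∃ K : ℝ, 0 ≤ K ∧
    ∀ (D : Set E) (g : E → F) (C B h : ℝ) (x y : E) (V : ℕ → E), IsOpen D → Convex ℝ D →
      DerivBdd D q C g → 0 ≤ C → 1 ≤ B → 0 < h → h ≤ 1 → x ∈ D → y ∈ D →
      (∀ t, t + 1 < q → ‖V t‖ ≤ B) →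
      ‖y - x - ∑ t ∈ range (q - 1), h ^ (t + 1) • V t‖ ≤ B * h ^ q →
      ‖g y - ∑ r ∈ range q, h ^ r • expansionCoef g x V r‖ ≤ K * C * B ^ q * h ^ q := by
  obtain ⟨K, hK, H⟩ := exists_norm_sub_sum_expansionCoef_le (E := E) (F := F) q
  refine ⟨K, hK, fun D g C B h x y V hD hc hg hC hB h0 h1 hx hy hV hyx => ?_⟩
  obtain ⟨q, rfl⟩ : ∃ q', q = q' + 1 := ⟨q - 1, by omega⟩
  rw [Nat.add_sub_cancel] at hyx
  set R := y - x - ∑ t ∈ range q, h ^ (t + 1) • V t with hR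
  -- The remainder, divided by its power of h, is taken as one last coefficient. This makes y - x an
  -- exact polynomial in h, and the expansion coefficients kept never see that extra entry.
  set W : ℕ → E := fun t => if t < q then V t else (h ^ (q + 1))⁻¹ • R with hW
  have hWV : ∀ t < q, V t = W t := fun t ht => by simp [hW, ht]
  have := H D g C B h x y W hD hc hg hC hB h0.le h1 hx hy ?_ ?_
  · rwa [sum_congr rfl fun r hr => by
      rw [expansionCoef_congr g x fun t ht => hWV t (by have := mem_range.1 hr; omega)]]
  · intro t _
    simp only [hW]
    split_ifs with ht
    · exact hV t (by omega)
    · rw [norm_smul, norm_inv, norm_pow, Real.norm_eq_abs, abs_of_pos h0, inv_mul_le_iff₀ (by positivity),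
        mul_comm]
      exact hyx
  · rw [sum_range_succ, sum_congr rfl fun t ht => by rw [← hWV t (mem_range.1 ht)]]
    simp only [hW, lt_irrefl, if_false]
    rw [smul_inv_smul₀ (by positivity), hR]
    abel

theorem expansionCoef_zero {E F : Type*} [NormedAddCommGroup E] [NormedSpace ℝ E]
    [NormedAddCommGroup F] [NormedSpace ℝ F] (g : E → F) (x : E) (V : ℕ → E) :
    expansionCoef g x V 0 = g x := by
  simp [expansionCoef]

theorem expansionCoef_succ_of_eq_zero {E F : Type*} [NormedAddCommGroup E] [NormedSpace ℝ E]
    [NormedAddCommGroup F] [NormedSpace ℝ F] (g : E → F) (x : E) {V : ℕ → E} (hV : ∀ t, V t = 0)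
    (r : ℕ) : expansionCoef g x V (r + 1) = 0 := by
  refine sum_eq_zero fun q hq => ?_
  obtain ⟨i, l⟩ := q
  have hq' : i + l = r + 1 := HasAntidiagonal.mem_antidiagonal.1 hq
  rw [sum_eq_zero, smul_zero]
  intro φ hφ
  have hφ' : ∑ j, φ j = l := (mem_piAntidiag.1 hφ).1
  cases i with
  | zero => simp at hφ'; omega
  | succ i => exact ContinuousMultilinearMap.map_coord_zero _ 0 (hV _)

/-- Geometric decay beats polynomial growth. This is what makes the estimates uniform in n despite
the growing memory. -/
theorem exists_sum_pow_mul_le {β : ℝ} (h0 : 0 < β) (h1 : β < 1) (N : ℕ) :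
    ∃ S : ℝ, 0 ≤ S ∧ ∀ n, ∑ k ∈ range n, β ^ k * ((k : ℝ) + 1) ^ N ≤ S := by
  have hs : Summable fun k : ℕ => β ^ k * ((k : ℝ) + 1) ^ N := by
    have h := (summable_nat_add_iff 1).2 (summable_pow_mul_geometric_of_norm_lt_one (r := β) N
      (by rw [Real.norm_eq_abs, abs_of_pos h0]; exact h1))
    refine (h.mul_left β⁻¹).congr fun k => ?_
    push_cast
    rw [pow_succ]
    field_simp
  have hnn : ∀ k : ℕ, 0 ≤ β ^ k * ((k : ℝ) + 1) ^ N := fun k => by positivity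
  exact ⟨_, tsum_nonneg hnn, fun n => hs.sum_le_tsum _ fun k _ => hnn k⟩

-- Uniform bounds for the coefficients and history terms

section Coefficients

variable {d : ℕ} {L : ℕ → ParamSpace d → ℝ} {β : ℝ}

theorem historyCoef_zero_lag (m n : ℕ) (x : ParamSpace d) : historyCoef L β m n 0 x = 0 := by
  rw [historyCoef_eq]; simp

/-- One formula covers both defining cases: at lag 0 the history terms vanish, so the k = 0 summand
survives only for m = 0. -/
theorem memorylessCoef_succ_eq {m n : ℕ} {x : ParamSpace d}
    (hL : ∀ n, ContDiffAt ℝ m (gradient (L n)) x) :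
    memorylessCoef L β (m + 1) n x = -∑ k ∈ range (n + 1), β ^ k •
      expansionCoef (gradient (L (n - k))) x (fun t => historyCoef L β (t + 1) n k x) m := by
  rcases m with _ | m
  · rw [memorylessCoef_one]
    simp_rw [expansionCoef_zero]
  · rw [memorylessCoef_of_two_le _ _ (by omega), range_eq_Ico,
      sum_eq_sum_Ico_succ_bot (Nat.succ_pos n), expansionCoef_succ_of_eq_zero _ _
        (fun t => historyCoef_zero_lag _ _ _), smul_zero, zero_add]
    congr 1
    refine sum_congr (by ext k; simp) fun k _ => ?_
    congr 1
    exact sum_antidiagonal_blockTerm (hL (n - k)) fun t => historyCoef L β (t + 1) n k x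

theorem historyCoef_eq_expansionCoef {m n a : ℕ} {x : ParamSpace d}
    (hf : ∀ j ∈ Icc 1 m, ∀ n, ContDiffAt ℝ (m - j : ℕ) (memorylessCoef L β j n) x) :
    historyCoef L β m n a x = -∑ s ∈ Icc 1 a, ∑ j ∈ Icc 1 m,
      expansionCoef (memorylessCoef L β j (n - s)) x
        (fun t => historyCoef L β (t + 1) n s x) (m - j) := by
  rw [historyCoef_eq]
  congr 1
  refine sum_congr rfl fun s _ => sum_congr rfl fun j hj => ?_
  exact sum_antidiagonal_blockTerm (hf j hj (n - s)) fun t => historyCoef L β (t + 1) n s x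

/-- The coefficients `f_j` are bounded uniformly in the step, and the history terms grow at most
polynomially in the lag, together with their derivatives. -/
theorem exists_derivBdd_coef {D : Set (ParamSpace d)} (hD : IsOpen D) (h0 : 0 < β) (h1 : β < 1)
    {R : ℕ} {M : ℝ} (hM : 0 ≤ M) (hL : ∀ n, DerivBdd D (R - 1) M (gradient (L n))) :
    ∀ m ≤ R, ∃ (C : ℝ) (N : ℕ), 1 ≤ C ∧ ∀ j ∈ Icc 1 m, ∀ n,
      DerivBdd D (R - j) C (memorylessCoef L β j n) ∧
      ∀ a : ℕ, DerivBdd D (R - j) (C * ((a : ℝ) + 1) ^ N) (historyCoef L β j n a) := by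
  intro m
  induction m with
  | zero => exact fun _ => ⟨1, 0, le_rfl, fun j hj => by simp at hj⟩
  | succ m ih =>
    intro hm
    obtain ⟨C, N, hC, hCN⟩ := ih (by omega)
    choose K hK HK using fun r =>
      DerivBdd.expansionCoef (F := ParamSpace d) hD (R - (m + 1)) r
    -- f_(m+1) contains up to m history factors, each of growth (k + 1)^N.
    obtain ⟨S, hS, hSn⟩ := exists_sum_pow_mul_le h0 h1 (N * m)
    have hB : ∀ k : ℕ, 1 ≤ C * ((k : ℝ) + 1) ^ N := fun k =>
      one_le_mul_of_one_le_of_one_le hC (one_le_pow₀ (by linarith [k.cast_nonneg (α := ℝ)]))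
    set Cf : ℝ := K m * M * C ^ m * S with hCf
    have hCf0 : 0 ≤ Cf := by have := hK m; positivity
    have hf : ∀ n, DerivBdd D (R - (m + 1)) Cf (memorylessCoef L β (m + 1) n) := by
      intro n
      have h2 : ∀ k ∈ range (n + 1), DerivBdd D (R - (m + 1))
          (|β ^ k| * (K m * M * (C * ((k : ℝ) + 1) ^ N) ^ m)) fun x => β ^ k •
          expansionCoef (gradient (L (n - k))) x (fun t => historyCoef L β (t + 1) n k x) m :=
        fun k _ => (HK m _ (fun t => historyCoef L β (t + 1) n k) M _ hM (hB k)
          ((hL (n - k)).mono (by omega) le_rfl) fun t ht =>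
            ((hCN (t + 1) (by simp; omega) n).2 k).mono (by omega) le_rfl).const_smul hD _
      refine (((DerivBdd.sum hD h2).neg hD).mono le_rfl ?_).congr fun x hx => ?_
      · calc _ = K m * M * C ^ m * ∑ k ∈ range (n + 1), β ^ k * ((k : ℝ) + 1) ^ (N * m) := by
              rw [mul_sum]
              refine sum_congr rfl fun k _ => ?_
              rw [abs_of_pos (by positivity), mul_pow, pow_mul]
              ring
          _ ≤ _ := by
              have := hK m
              exact mul_le_mul_of_nonneg_left (hSn _) (by positivity)
      · exact memorylessCoef_succ_eq fun n =>
          ((hL n).mono (by omega) le_rfl).contDiffAt hD hx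
    have hfj : ∀ j ∈ Icc 1 (m + 1), ∀ n, DerivBdd D (R - j) (C + Cf) (memorylessCoef L β j n) := by
      intro j hj n
      have hj' := mem_Icc.1 hj
      rcases hj'.2.eq_or_lt with rfl | h
      · exact (hf n).mono le_rfl (by linarith)
      · exact (hCN j (by simp; omega) n).1.mono le_rfl (by linarith)
    set CH : ℝ := (∑ j ∈ Icc 1 (m + 1), K (m + 1 - j)) * (C + Cf) * C ^ (m + 1) with hCH
    have hsK : 0 ≤ ∑ j ∈ Icc 1 (m + 1), K (m + 1 - j) := sum_nonneg fun j _ => hK _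
    have hCH0 : 0 ≤ CH := by positivity
    -- The final + 1 in the exponent pays for the sum over the a values of s. The new f_(m+1) enters
    -- here, so it had to be bounded first.
    have hH : ∀ n a : ℕ, DerivBdd D (R - (m + 1)) (CH * ((a : ℝ) + 1) ^ (N * (m + 1) + 1))
        (historyCoef L β (m + 1) n a) := by
      intro n a
      have h2 : ∀ s ∈ Icc 1 a, ∀ j ∈ Icc 1 (m + 1), DerivBdd D (R - (m + 1))
          (K (m + 1 - j) * (C + Cf) * (C * ((s : ℝ) + 1) ^ N) ^ (m + 1 - j)) fun x =>
          expansionCoef (memorylessCoef L β j (n - s)) x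
            (fun t => historyCoef L β (t + 1) n s x) (m + 1 - j) := by
        intro s _ j hj
        have hj' := mem_Icc.1 hj
        exact HK (m + 1 - j) _ (fun t => historyCoef L β (t + 1) n s) _ _ (by positivity) (hB s)
          ((hfj j hj (n - s)).mono (by omega) le_rfl) fun t ht =>
            ((hCN (t + 1) (by simp; omega) n).2 s).mono (by omega) le_rfl
      refine (((DerivBdd.sum hD fun s hs => DerivBdd.sum hD (h2 s hs)).neg hD).mono le_rfl
        ?_).congr fun x hx => ?_
      · have hbound : ∀ s ∈ Icc 1 a, ∑ j ∈ Icc 1 (m + 1),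
            K (m + 1 - j) * (C + Cf) * (C * ((s : ℝ) + 1) ^ N) ^ (m + 1 - j) ≤
            CH * ((a : ℝ) + 1) ^ (N * (m + 1)) := by
          intro s hs
          have hsa : (s : ℝ) ≤ a := by exact_mod_cast (mem_Icc.1 hs).2
          calc _ ≤ ∑ j ∈ Icc 1 (m + 1),
                K (m + 1 - j) * (C + Cf) * (C * ((a : ℝ) + 1) ^ N) ^ (m + 1) := by
                refine sum_le_sum fun j _ => mul_le_mul_of_nonneg_left ?_
                  (mul_nonneg (hK _) (by positivity))
                refine (pow_le_pow_right₀ (hB s) (Nat.sub_le _ _)).trans ?_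
                gcongr
            _ = _ := by
                rw [← sum_mul, ← sum_mul, mul_pow, ← pow_mul, hCH]
                ring
        refine (sum_le_sum hbound).trans ?_
        rw [sum_const, Nat.card_Icc, Nat.add_sub_cancel, nsmul_eq_mul, pow_succ]
        have : 0 ≤ CH * ((a : ℝ) + 1) ^ (N * (m + 1)) := by positivity
        nlinarith
      · refine historyCoef_eq_expansionCoef fun j hj n => ?_
        exact ((hfj j hj n).mono (by omega) le_rfl).contDiffAt hD hx
    refine ⟨C + Cf + CH, N * (m + 1) + 1, by linarith, fun j hj n => ⟨?_, fun a => ?_⟩⟩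
    · exact (hfj j hj n).mono le_rfl (by linarith)
    · have hj' := mem_Icc.1 hj
      have ha : (1 : ℝ) ≤ (a : ℝ) + 1 := by linarith [a.cast_nonneg (α := ℝ)]
      rcases hj'.2.eq_or_lt with rfl | h
      · refine (hH n a).mono le_rfl ?_
        gcongr
        linarith
      · refine ((hCN j (by simp; omega) n).2 a).mono le_rfl ?_
        gcongr
        · linarith
        · nlinarith

end Coefficients

-- History expansion and local error

theorem sum_range_smul_sum_Icc {E : Type*} [AddCommGroup E] [Module ℝ E] (h : ℝ) (Q : ℕ)
    (c : ℕ → ℕ → E) :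
    ∑ t ∈ range Q, h ^ (t + 1) • ∑ j ∈ Icc 1 (t + 1), c j (t + 1 - j) =
      ∑ j ∈ Icc 1 Q, h ^ j • ∑ r ∈ range (Q + 1 - j), h ^ r • c j r := by
  simp_rw [smul_sum, smul_smul, ← pow_add]
  rw [sum_sigma', sum_sigma']
  refine sum_bij' (fun z _ => ⟨z.2, z.1 + 1 - z.2⟩) (fun z _ => ⟨z.1 + z.2 - 1, z.1⟩)
    ?_ ?_ ?_ ?_ ?_
  · rintro ⟨t, j⟩ hz
    simp only [mem_sigma, mem_range, mem_Icc] at hz ⊢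
    omega
  · rintro ⟨j, r⟩ hz
    simp only [mem_sigma, mem_range, mem_Icc] at hz ⊢
    omega
  · rintro ⟨t, j⟩ hz
    simp only [mem_sigma, mem_range, mem_Icc] at hz
    simp only [Sigma.mk.injEq, heq_eq_eq, and_true]
    omega
  · rintro ⟨j, r⟩ hz
    simp only [mem_sigma, mem_range, mem_Icc] at hz
    simp only [Sigma.mk.injEq, heq_eq_eq, true_and]
    omega
  · rintro ⟨t, j⟩ hz
    simp only [mem_sigma, mem_range, mem_Icc] at hz
    simp only
    rw [Nat.add_sub_cancel' hz.2.2]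

section Iteration

variable {d : ℕ} {L : ℕ → ParamSpace d → ℝ} {β : ℝ}

theorem IsMemoryless.sub_eq {h : ℝ} {p : ℕ} {θ : ℕ → ParamSpace d} (hθ : IsMemoryless L β h p θ)
    {n a : ℕ} (ha : a ≤ n) :
    θ (n - a) - θ n =
      -∑ s ∈ Icc 1 a, ∑ j ∈ Icc 1 p, h ^ j • memorylessCoef L β j (n - s) (θ (n - s)) := by
  induction a with
  | zero => simp
  | succ a ih =>
    rw [sum_Icc_succ_top (by omega), neg_add, ← ih (by omega)]
    have := hθ (n - (a + 1))
    rw [show n - (a + 1) + 1 = n - a by omega] at this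
    rw [this]
    abel

/-- Earlier iterates of the memoryless iteration are approximated by the history terms. -/
theorem exists_history_approx {D : Set (ParamSpace d)} (hD : IsOpen D) (hc : Convex ℝ D) {p : ℕ}
    {C : ℝ} {N : ℕ} (hC : 1 ≤ C) (hcoef : ∀ j ∈ Icc 1 p, ∀ n,
      DerivBdd D (2 * p - j) C (memorylessCoef L β j n) ∧
      ∀ a : ℕ, DerivBdd D (2 * p - j) (C * ((a : ℝ) + 1) ^ N) (historyCoef L β j n a)) :
    ∀ Q ≤ p, ∃ (B : ℝ) (N' : ℕ), 0 ≤ B ∧ ∀ q ∈ Icc 1 Q, ∀ (h : ℝ) (θ : ℕ → ParamSpace d), 0 < h →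
      h ≤ 1 → (∀ n, θ n ∈ D) → IsMemoryless L β h p θ → ∀ n a, a ≤ n →
      ‖θ (n - a) - θ n - ∑ t ∈ range (q - 1), h ^ (t + 1) • historyCoef L β (t + 1) n a (θ n)‖ ≤
        B * ((a : ℝ) + 1) ^ N' * h ^ q := by
  intro Q
  induction Q with
  | zero => exact fun _ => ⟨0, 0, le_rfl, fun q hq => by simp at hq⟩
  | succ Q ih =>
    intro hQ
    obtain ⟨B, N', hB, hBN⟩ := ih (by omega)
    choose K hK HK using fun r : ℕ =>
      exists_norm_sub_sum_expansionCoef_le_of_approx (E := ParamSpace d) (F := ParamSpace d)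
        (Nat.succ_le_succ (Nat.zero_le r))
    have hsK : 0 ≤ ∑ j ∈ Icc 1 Q, K (Q - j) := sum_nonneg fun j _ => hK _
    -- The first summand bounds the expansion errors of the f_j with j ≤ Q, the second the orders j
    -- > Q, which are simply discarded.
    set B' : ℝ := (∑ j ∈ Icc 1 Q, K (Q - j)) * C * (B + C) ^ (Q + 1) + p * C with hB'
    have hB'0 : 0 ≤ B' := by positivity
    have hstep : ∀ (h : ℝ) (θ : ℕ → ParamSpace d), 0 < h →
        h ≤ 1 → (∀ n, θ n ∈ D) → IsMemoryless L β h p θ → ∀ n a, a ≤ n →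
        ‖θ (n - a) - θ n - ∑ t ∈ range Q, h ^ (t + 1) • historyCoef L β (t + 1) n a (θ n)‖ ≤
          B' * ((a : ℝ) + 1) ^ ((N + N') * (Q + 1) + 1) * h ^ (Q + 1) := by
      intro h θ h0 h1 hθ hmem n a ha
      set e : ℕ → ℕ → ℕ → ParamSpace d := fun s j r =>
        expansionCoef (memorylessCoef L β j (n - s)) (θ n)
          (fun t => historyCoef L β (t + 1) n s (θ n)) r with he
      have hhist : ∑ t ∈ range Q, h ^ (t + 1) • historyCoef L β (t + 1) n a (θ n) =
          -∑ s ∈ Icc 1 a, ∑ j ∈ Icc 1 Q, h ^ j • ∑ r ∈ range (Q + 1 - j), h ^ r • e s j r := by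
        simp_rw [← sum_range_smul_sum_Icc]
        rw [sum_comm, ← sum_neg_distrib]
        refine sum_congr rfl fun t ht => ?_
        rw [← smul_sum, ← smul_neg, historyCoef_eq_expansionCoef]
        intro j hj n'
        have ht' := mem_range.1 ht
        have hj' := mem_Icc.1 hj
        exact ((hcoef j (by simp; omega) n').1.mono (by omega) le_rfl).contDiffAt hD (hθ n)
      have hsplit : ∀ s, ∑ j ∈ Icc 1 p, h ^ j • memorylessCoef L β j (n - s) (θ (n - s)) =
          ∑ j ∈ Icc 1 Q, h ^ j • memorylessCoef L β j (n - s) (θ (n - s)) +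
          ∑ j ∈ Ioc Q p, h ^ j • memorylessCoef L β j (n - s) (θ (n - s)) := by
        intro s
        rw [← sum_union]
        · congr 1; ext j; simp; omega
        · rw [disjoint_left]; intro j; simp; omega
      rw [hmem.sub_eq ha, hhist, sub_neg_eq_add, neg_add_eq_sub, norm_sub_rev,
        ← sum_sub_distrib]
      simp_rw [hsplit, add_sub_right_comm, ← sum_sub_distrib, ← smul_sub]
      have hterm : ∀ s ∈ Icc 1 a,
          ‖∑ j ∈ Icc 1 Q, h ^ j • (memorylessCoef L β j (n - s) (θ (n - s)) -
              ∑ r ∈ range (Q + 1 - j), h ^ r • e s j r) +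
            ∑ j ∈ Ioc Q p, h ^ j • memorylessCoef L β j (n - s) (θ (n - s))‖ ≤
          B' * ((a : ℝ) + 1) ^ ((N + N') * (Q + 1)) * h ^ (Q + 1) := by
        intro s hs
        have hs' := mem_Icc.1 hs
        have hsa : (s : ℝ) ≤ a := by exact_mod_cast hs'.2
        have hs1 : (1 : ℝ) ≤ (s : ℝ) + 1 := by linarith [s.cast_nonneg (α := ℝ)]
        have ha1 : (1 : ℝ) ≤ (a : ℝ) + 1 := by linarith [a.cast_nonneg (α := ℝ)]
        have hBs1 : 1 ≤ (B + C) * ((s : ℝ) + 1) ^ (N + N') :=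
          one_le_mul_of_one_le_of_one_le (by linarith) (one_le_pow₀ hs1)
        have hX : ((B + C) * ((s : ℝ) + 1) ^ (N + N')) ^ (Q + 1) ≤
            (B + C) ^ (Q + 1) * ((a : ℝ) + 1) ^ ((N + N') * (Q + 1)) := by
          rw [mul_pow, ← pow_mul]
          gcongr
        have hlow : ‖∑ j ∈ Icc 1 Q, h ^ j • (memorylessCoef L β j (n - s) (θ (n - s)) -
              ∑ r ∈ range (Q + 1 - j), h ^ r • e s j r)‖ ≤
            ∑ j ∈ Icc 1 Q, K (Q - j) * (C * ((B + C) ^ (Q + 1) *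
              ((a : ℝ) + 1) ^ ((N + N') * (Q + 1))) * h ^ (Q + 1)) := by
          refine (norm_sum_le _ _).trans (sum_le_sum fun j hj => ?_)
          have hj' := mem_Icc.1 hj
          have hj1 : Q - j + 1 = Q + 1 - j := by omega
          -- The prefactor h^j with j ≥ 1 lets f_j be expanded only to order Q + 1 - j ≤ Q, for
          -- which the inductive approximation of the earlier iterate suffices.
          have := HK (Q - j) D (memorylessCoef L β j (n - s)) C
            ((B + C) * ((s : ℝ) + 1) ^ (N + N')) h (θ n) (θ (n - s))
            (fun t => historyCoef L β (t + 1) n s (θ n)) hD hc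
            ((hcoef j (by simp; omega) (n - s)).1.mono (by omega) le_rfl) (by linarith) hBs1 h0 h1
            (hθ n) (hθ _) (fun t ht => ?_) ?_
          · rw [Nat.succ_eq_add_one, hj1] at this
            rw [norm_smul, norm_pow, Real.norm_eq_abs, abs_of_pos h0]
            calc _ ≤ h ^ j * (K (Q - j) * C * ((B + C) * ((s : ℝ) + 1) ^ (N + N')) ^ (Q + 1 - j) *
                  h ^ (Q + 1 - j)) := by gcongr
              _ = K (Q - j) * (C * ((B + C) * ((s : ℝ) + 1) ^ (N + N')) ^ (Q + 1 - j) *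
                  h ^ (Q + 1)) := by
                  rw [show h ^ (Q + 1) = h ^ j * h ^ (Q + 1 - j) by
                    rw [← pow_add]; congr 1; omega]
                  ring
              _ ≤ _ := by
                  refine mul_le_mul_of_nonneg_left ?_ (hK _)
                  gcongr
                  exact (pow_le_pow_right₀ hBs1 (Nat.sub_le _ _)).trans hX
          · refine (((hcoef (t + 1) (by simp; omega) n).2 s).norm_le (hθ n)).trans ?_
            gcongr
            · linarith
            · omega
          · refine (hBN (Q - j + 1) (by simp; omega) h θ h0 h1 hθ hmem n s (by omega)).trans ?_
            gcongr
            · linarith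
            · omega
        have hhigh : ‖∑ j ∈ Ioc Q p, h ^ j • memorylessCoef L β j (n - s) (θ (n - s))‖ ≤
            p * C * h ^ (Q + 1) := by
          refine (norm_sum_le _ _).trans ?_
          calc _ ≤ ∑ j ∈ Ioc Q p, h ^ (Q + 1) * C := by
                refine sum_le_sum fun j hj => ?_
                have hj' := mem_Ioc.1 hj
                rw [norm_smul, norm_pow, Real.norm_eq_abs, abs_of_pos h0]
                refine mul_le_mul (pow_le_pow_of_le_one h0.le h1 (by omega))
                  ((hcoef j (by simp; omega) _).1.norm_le (hθ _)) (norm_nonneg _) (by positivity)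
            _ ≤ _ := by
                rw [sum_const, Nat.card_Ioc, nsmul_eq_mul, mul_comm (h ^ (Q + 1)), mul_assoc]
                gcongr
                omega
        refine (norm_add_le _ _).trans ((add_le_add hlow hhigh).trans ?_)
        rw [← sum_mul, hB']
        have : (1 : ℝ) ≤ ((a : ℝ) + 1) ^ ((N + N') * (Q + 1)) := one_le_pow₀ ha1
        have h3 : 0 ≤ p * C * h ^ (Q + 1) := by positivity
        nlinarith
      refine (norm_sum_le _ _).trans ((sum_le_sum hterm).trans ?_)
      rw [sum_const, Nat.card_Icc, Nat.add_sub_cancel, nsmul_eq_mul, pow_succ _ ((N + N') * (Q + 1))]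
      have : 0 ≤ B' * ((a : ℝ) + 1) ^ ((N + N') * (Q + 1)) * h ^ (Q + 1) := by positivity
      nlinarith
    refine ⟨B + B', N' + ((N + N') * (Q + 1) + 1), by positivity,
      fun q hq h θ h0 h1 hθ hmem n a ha => ?_⟩
    have hq' := mem_Icc.1 hq
    have ha1 : (1 : ℝ) ≤ (a : ℝ) + 1 := by linarith [a.cast_nonneg (α := ℝ)]
    rcases hq'.2.eq_or_lt with rfl | hlt
    · refine (hstep h θ h0 h1 hθ hmem n a ha).trans ?_
      gcongr ?_ * _ ^ ?_ * _
      · linarith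
      · exact Nat.le_add_left _ _
    · refine (hBN q (by simp; omega) h θ h0 h1 hθ hmem n a ha).trans ?_
      gcongr
      · linarith
      · exact Nat.le_add_right _ _

/-- The memoryless iteration satisfies the heavy-ball recursion up to `O(h ^ (p + 1))`. -/
theorem exists_local_error_le {D : Set (ParamSpace d)} (hD : IsOpen D) (hc : Convex ℝ D)
    (h0 : 0 < β) (h1 : β < 1) {p : ℕ} (hp : 1 ≤ p) {M : ℝ} (hM : 0 ≤ M)
    (hL : ∀ n, DerivBdd D (2 * p - 1) M (gradient (L n))) :
    ∃ C₁ : ℝ, 0 ≤ C₁ ∧ ∀ (h : ℝ) (θ : ℕ → ParamSpace d), 0 < h → h ≤ 1 →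
      (∀ n, θ n ∈ D) → IsMemoryless L β h p θ → ∀ n,
      ‖θ (n + 1) - θ n +
        h • ∑ k ∈ range (n + 1), β ^ k • gradient (L (n - k)) (θ (n - k))‖ ≤ C₁ * h ^ (p + 1) := by
  obtain ⟨C, N, hC, hcoef⟩ := exists_derivBdd_coef hD h0 h1 hM hL p (by omega)
  obtain ⟨B, N', hB, hBN⟩ := exists_history_approx hD hc hC hcoef p le_rfl
  obtain ⟨K, hK, HK⟩ :=
    exists_norm_sub_sum_expansionCoef_le_of_approx (E := ParamSpace d) (F := ParamSpace d) hp
  obtain ⟨S, hS, hSn⟩ := exists_sum_pow_mul_le h0 h1 ((N + N') * p)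
  refine ⟨K * M * (B + C) ^ p * S, by positivity, fun h θ hh0 hh1 hθ hmem n => ?_⟩
  set e : ℕ → ℕ → ParamSpace d := fun k r =>
    expansionCoef (gradient (L (n - k))) (θ n) (fun t => historyCoef L β (t + 1) n k (θ n)) r
    with he
  -- The increment is the heavy-ball sum with every gradient replaced by its truncated expansion, so
  -- the local error is a β-weighted sum of truncation errors.
  have hsum : ∑ j ∈ Icc 1 p, h ^ j • memorylessCoef L β j n (θ n) =
      -(h • ∑ k ∈ range (n + 1), β ^ k • ∑ r ∈ range p, h ^ r • e k r) := by
    have h2 : ∑ j ∈ Icc 1 p, h ^ j • memorylessCoef L β j n (θ n) =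
        ∑ r ∈ range p, h ^ (r + 1) • memorylessCoef L β (r + 1) n (θ n) := by
      rw [range_eq_Ico, sum_Ico_add' (fun j => h ^ j • memorylessCoef L β j n (θ n)) 0 p 1]
      refine sum_congr (by ext j; simp) fun _ _ => rfl
    have h3 : ∀ r ∈ range p, h ^ (r + 1) • memorylessCoef L β (r + 1) n (θ n) =
        -(h • ∑ k ∈ range (n + 1), β ^ k • h ^ r • e k r) := by
      intro r hr
      have hr' := mem_range.1 hr
      rw [memorylessCoef_succ_eq fun n' =>
        ((hL n').mono (by omega) le_rfl).contDiffAt hD (hθ n), pow_succ', mul_smul, smul_neg,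
        smul_neg, smul_sum]
      simp_rw [smul_comm (h ^ r)]
      rfl
    rw [h2, sum_congr rfl h3, sum_neg_distrib, ← smul_sum, sum_comm]
    simp_rw [smul_sum]
  have hterm : ∀ k ∈ range (n + 1), ‖β ^ k • (gradient (L (n - k)) (θ (n - k)) -
      ∑ r ∈ range p, h ^ r • e k r)‖ ≤
      K * M * (B + C) ^ p * h ^ p * (β ^ k * ((k : ℝ) + 1) ^ ((N + N') * p)) := by
    intro k hk
    have hk' := mem_range.1 hk
    have hk1 : (1 : ℝ) ≤ (k : ℝ) + 1 := by linarith [k.cast_nonneg (α := ℝ)]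
    have := HK D (gradient (L (n - k))) M ((B + C) * ((k : ℝ) + 1) ^ (N + N')) h (θ n) (θ (n - k))
      (fun t => historyCoef L β (t + 1) n k (θ n)) hD hc ((hL _).mono (by omega) le_rfl) hM
      (one_le_mul_of_one_le_of_one_le (by linarith) (one_le_pow₀ hk1)) hh0 hh1 (hθ _) (hθ _)
      (fun t ht => ?_) ?_
    · rw [norm_smul, norm_pow, Real.norm_eq_abs, abs_of_pos h0]
      calc _ ≤ β ^ k * (K * M * ((B + C) * ((k : ℝ) + 1) ^ (N + N')) ^ p * h ^ p) := by gcongr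
        _ = _ := by rw [mul_pow, ← pow_mul]; ring
    · refine (((hcoef (t + 1) (by simp; omega) n).2 k).norm_le (hθ n)).trans ?_
      gcongr
      · linarith
      · omega
    · refine (hBN p (by simp; omega) h θ hh0 hh1 hθ hmem n k (by omega)).trans ?_
      gcongr
      · linarith
      · omega
  rw [hmem n, add_sub_cancel_left, hsum, neg_add_eq_sub, ← smul_sub, ← sum_sub_distrib]
  simp_rw [← smul_sub]
  rw [norm_smul, Real.norm_eq_abs, abs_of_pos hh0]
  calc _ ≤ h * (K * M * (B + C) ^ p * h ^ p * S) := by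
        gcongr
        refine (norm_sum_le _ _).trans ((sum_le_sum hterm).trans ?_)
        rw [← mul_sum]
        gcongr
        exact hSn _
    _ = _ := by ring

-- Stability and conclusion

/-- Stability of the heavy-ball recursion with respect to perturbations. -/
theorem norm_sub_le_of_perturbed_heavyBall {D : Set (ParamSpace d)} {h M S τ : ℝ} (h0 : 0 ≤ h)
    (hβ : 0 ≤ β) (hM : 0 ≤ M) (hS0 : 0 ≤ S) (hS : ∀ n, ∑ k ∈ range n, β ^ k ≤ S) (hτ : 0 ≤ τ)
    (hL : ∀ n, ∀ x ∈ D, ∀ y ∈ D, ‖gradient (L n) x - gradient (L n) y‖ ≤ M * ‖x - y‖)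
    {θ θ' : ℕ → ParamSpace d} (hθ : ∀ n, θ n ∈ D) (hb : IsHeavyBall L β h θ)
    (hθ' : ∀ n, θ' n ∈ D) (herr : ∀ n, ‖θ' (n + 1) - θ' n +
      h • ∑ k ∈ range (n + 1), β ^ k • gradient (L (n - k)) (θ' (n - k))‖ ≤ τ)
    (hinit : θ' 0 = θ 0) (n : ℕ) :
    ‖θ n - θ' n‖ ≤ n * τ * (1 + h * (M * S)) ^ n := by
  have hg : 1 ≤ 1 + h * (M * S) := by
    have : 0 ≤ h * (M * S) := by positivity
    linarith
  induction n using Nat.strong_induction_on with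
  | _ n ih =>
    rcases n with _ | n
    · simp [hinit]
    -- The claimed bound increases with the step, so b dominates all past errors at once and the
    -- memory term costs at most h M S b.
    have hmono : ∀ k ≤ n, (k : ℝ) * τ * (1 + h * (M * S)) ^ k ≤
        n * τ * (1 + h * (M * S)) ^ n := by
      intro k hk
      have : (k : ℝ) ≤ n := by exact_mod_cast hk
      gcongr
    set b := (n : ℝ) * τ * (1 + h * (M * S)) ^ n with hbdef
    have hb0 : 0 ≤ b := by positivity
    have heq : θ (n + 1) - θ' (n + 1) = (θ n - θ' n) -
        h • ∑ k ∈ range (n + 1), β ^ k •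
          (gradient (L (n - k)) (θ (n - k)) - gradient (L (n - k)) (θ' (n - k))) -
        (θ' (n + 1) - θ' n +
          h • ∑ k ∈ range (n + 1), β ^ k • gradient (L (n - k)) (θ' (n - k))) := by
      rw [hb n]
      simp_rw [smul_sub, sum_sub_distrib, smul_sub]
      abel
    have hmid : ‖h • ∑ k ∈ range (n + 1), β ^ k •
          (gradient (L (n - k)) (θ (n - k)) - gradient (L (n - k)) (θ' (n - k)))‖ ≤
        h * (M * S) * b := by
      rw [norm_smul, Real.norm_eq_abs, abs_of_nonneg h0, mul_assoc]
      refine mul_le_mul_of_nonneg_left ?_ h0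
      calc _ ≤ ∑ k ∈ range (n + 1), β ^ k * (M * b) := by
            refine (norm_sum_le _ _).trans (sum_le_sum fun k _ => ?_)
            rw [norm_smul, norm_pow, Real.norm_eq_abs, abs_of_nonneg hβ]
            gcongr
            refine (hL _ _ (hθ _) _ (hθ' _)).trans ?_
            gcongr
            exact (ih _ (by omega)).trans (hmono _ (Nat.sub_le _ _))
        _ ≤ S * (M * b) := by
            rw [← sum_mul]
            exact mul_le_mul_of_nonneg_right (hS _) (by positivity)
        _ = _ := by ring
    have hn := (ih n (by omega)).trans (hmono n le_rfl)
    have h1 : ‖θ (n + 1) - θ' (n + 1)‖ ≤ b + h * (M * S) * b + τ := by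
      rw [heq]
      refine (norm_sub_le _ _).trans (add_le_add ((norm_sub_le _ _).trans (add_le_add hn hmid)) ?_)
      exact herr n
    have h2 : τ ≤ τ * (1 + h * (M * S)) ^ (n + 1) := le_mul_of_one_le_right hτ (one_le_pow₀ hg)
    calc _ ≤ b + h * (M * S) * b + τ := h1
      _ ≤ b + h * (M * S) * b + τ * (1 + h * (M * S)) ^ (n + 1) := by linarith
      _ = _ := by rw [hbdef]; push_cast; ring

end Iteration

end

theorem theorem2 (d p : ℕ) (hp : 2 ≤ p) (β : ℝ) (hβ₀ : 0 < β) (hβ₁ : β < 1)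
    (T : ℝ) (hT : 0 < T)
    (D : Set (ParamSpace d)) (hD_open : IsOpen D) (hD_convex : Convex ℝ D)
    (L : ℕ → ParamSpace d → ℝ)
    (hL_smooth : ∀ n, ContDiffOn ℝ ((2 * p : ℕ) : WithTop ℕ∞) (L n) D)
    (hL_bdd : ∃ M : ℝ, ∀ n, ∀ r ∈ Finset.Icc 1 (2 * p), ∀ x ∈ D,
      ‖iteratedFDeriv ℝ r (L n) x‖ ≤ M) :
    ∃ C₁ C₂ : ℝ, ∀ h : ℝ, 0 < h → h < 1 / 2 →
      ∀ θ θ' : ℕ → ParamSpace d,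
        (∀ n, θ n ∈ D) → IsHeavyBall L β h θ →
        (∀ n, θ' n ∈ D) → IsMemoryless L β h p θ' →
        θ' 0 = θ 0 →
        (∀ n ≤ ⌊T / h⌋₊,
          ‖θ' (n + 1) - θ' n +
            h • ∑ k ∈ Finset.range (n + 1), β ^ k • gradient (L (n - k)) (θ' (n - k))‖
              ≤ C₁ * h ^ (p + 1)) ∧
        (∀ n ≤ ⌊T / h⌋₊, ‖θ n - θ' n‖ ≤ C₂ * h ^ p) := by
  obtain ⟨M₀, hM₀⟩ := hL_bdd
  have hgrad : ∀ n, DerivBdd D (2 * p - 1) |M₀| (gradient (L n)) := fun n =>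
    DerivBdd.gradient hD_open (by rw [Nat.sub_add_cancel (by omega)]; exact hL_smooth n)
      fun r hr x hx => (hM₀ n r (by rwa [Nat.sub_add_cancel (by omega)] at hr) x hx).trans
        (le_abs_self _)
  have hlip : ∀ n, ∀ x ∈ D, ∀ y ∈ D,
      ‖gradient (L n) x - gradient (L n) y‖ ≤ |M₀| * ‖x - y‖ := fun n x hx y hy =>
    hD_convex.norm_image_sub_le_of_norm_fderiv_le
      (fun z hz => ((hgrad n).contDiffAt hD_open hz).differentiableAt
        (by exact_mod_cast (by omega : 2 * p - 1 ≠ 0)))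
      (fun z hz => by
        rw [← norm_iteratedFDeriv_one]
        exact (hgrad n).norm_iteratedFDeriv_le hD_open (by omega) hz) hy hx
  obtain ⟨C₁, hC₁, hloc⟩ :=
    exists_local_error_le hD_open hD_convex hβ₀ hβ₁ (by omega) (abs_nonneg M₀) hgrad
  obtain ⟨S, hS, hSn⟩ := exists_sum_pow_mul_le hβ₀ hβ₁ 0
  -- The second constant comes from n h ≤ T and (1 + h |M₀| S)^n ≤ exp(n h |M₀| S).
  refine ⟨C₁, C₁ * T * Real.exp (T * (|M₀| * S)), fun h h0 h1 θ θ' hθ hb hθ' hm hinit => ?_⟩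
  have herr := hloc h θ' h0 (by linarith) hθ' hm
  refine ⟨fun n _ => herr n, fun n hn => ?_⟩
  have hnT : (n : ℝ) * h ≤ T := by
    rw [← le_div_iff₀ h0]
    exact (Nat.le_floor_iff (by positivity)).1 hn
  calc _ ≤ n * (C₁ * h ^ (p + 1)) * (1 + h * (|M₀| * S)) ^ n :=
        norm_sub_le_of_perturbed_heavyBall h0.le hβ₀.le (abs_nonneg _) hS
          (by simpa using hSn) (by positivity) hlip hθ hb hθ' herr hinit n
    _ = C₁ * (n * h) * (1 + h * (|M₀| * S)) ^ n * h ^ p := by ring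
    _ ≤ C₁ * T * Real.exp (T * (|M₀| * S)) * h ^ p := by
        gcongr
        calc (1 + h * (|M₀| * S)) ^ n ≤ Real.exp (h * (|M₀| * S)) ^ n := by
              gcongr
              rw [add_comm]
              exact Real.add_one_le_exp _
          _ = Real.exp (n * h * (|M₀| * S)) := by rw [← Real.exp_nat_mul, mul_assoc]
          _ ≤ _ := by gcongr
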